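/- Let $\mathbf P$ be a countable set of proposition letters, given with an effective (primitive recursive) coding by natural numbers. The formulas of $\mathbf{PL}$ are $\alpha ::= p\mid\bot\mid(\alpha\land\alpha)\mid(\alpha\lor\alpha)\mid(\alpha\to\alpha)$ with $p\in\mathbf P$, and the formulas of $\mathbf{DELKh}$ are $$\varphi ::= p\mid\bot\mid(\varphi\land\varphi)\mid(\varphi\lor\varphi)\mid(\varphi\to\varphi)\mid\mathsf K\varphi\mid\mathsf{Kh}\,\alpha\mid\Box\varphi\qquad(p\in\mathbf P,\ \alpha\in\mathbf{PL}).$$ Write $\neg\varphi$ for $\varphi\to\bot$, $\top$ for $\neg\bot$, $\varphi\leftrightarrow\psi$ for $(\varphi\to\psi)\land(\psi\to\varphi)$, $\widehat{\mathsf K}$ for $\neg\mathsf K\neg$ and $\Diamond$ for $\neg\Box\neg$. The Hilbert system $\mathsf{SDELKh}$ has the following axioms, for all $p\in\mathbf P$, $\alpha,\beta,\alpha_1,\dots,\alpha_k\in\mathbf{PL}$, $k\in\mathbb N$ (empty conjunctions being $\top$) and $\varphi,\psi\in\mathbf{DELKh}$: * all instances in $\mathbf{DELKh}$ of propositional tautologies;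 * $\mathsf K(\varphi\to\psi)\to(\mathsf K\varphi\to\mathsf K\psi)$, $\ \mathsf K\varphi\to\varphi$, $\ \mathsf K\varphi\to\mathsf K\mathsf K\varphi$, $\ \neg\mathsf K\varphi\to\mathsf K\neg\mathsf K\varphi$; * $\Box(\varphi\to\psi)\to(\Box\varphi\to\Box\psi)$, $\ \Box\varphi\to\varphi$, $\ \Box\varphi\to\Box\Box\varphi$, $\ \mathsf K\Box\varphi\to\Box\mathsf K\varphi$; * $\alpha\to\Box\alpha$, $\ \alpha\to\Diamond\mathsf{Kh}\,\alpha$, $\ \mathsf{Kh}\,\alpha\to\mathsf K\alpha$, $\ \mathsf Kp\to\mathsf{Kh}\,p$, $\ \mathsf{Kh}\,\bot\leftrightarrow\bot$; * $\mathsf{Kh}(\alpha\lor\beta)\leftrightarrow(\mathsf{Kh}\,\alpha\lor\mathsf{Kh}\,\beta)$, $\ \mathsf{Kh}(\alpha\land\beta)\leftrightarrow(\mathsf{Kh}\,\alpha\land\mathsf{Kh}\,\beta)$, $\ \mathsf{Kh}(\alpha\to\beta)\leftrightarrow\mathsf K\Box(\mathsf{Kh}\,\alpha\to\mathsf{Kh}\,\beta)$;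 * $\mathsf{Kh}\,\alpha\to\mathsf K\mathsf{Kh}\,\alpha$, $\ \neg\mathsf{Kh}\,\alpha\to\mathsf K\neg\mathsf{Kh}\,\alpha$; * $\alpha\land\bigwedge_{1\le i\le k}\widehat{\mathsf K}(\alpha\land\alpha_i)\to\Diamond\bigl(\mathsf K\alpha\land\bigwedge_{1\le i\le k}\widehat{\mathsf K}\alpha_i\bigr)$; and the rules: from $\varphi$ and $\varphi\to\psi$ infer $\psi$; from $\vdash\varphi$ infer $\vdash\mathsf K\varphi$; from $\vdash\varphi$ infer $\vdash\Box\varphi$. Then $\mathsf{SDELKh}$ is decidable: there is an algorithm which, given any formula $\varphi$ of $\mathbf{DELKh}$ (as its Gödel number), decides whether $\varphi$ is provable in $\mathsf{SDELKh}$. -/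

import Mathlib

namespace SDELKh

universe u

/-- Formulas of the propositional language `PL` over the proposition letters `P`. -/
inductive PL (P : Type u) : Type u
  | atom : P → PL P
  | bot : PL P
  | and : PL P → PL P → PL P
  | or : PL P → PL P → PL P
  | imp : PL P → PL P → PL P

/-- Formulas of the dynamic epistemic language of knowing how `DELKh` over the proposition
letters `P`. The know-how modality `Kh` applies to propositional formulas only. -/
inductive Formula (P : Type u) : Type u
  | atom : P → Formula P
  | bot : Formula P
  | and : Formula P → Formula P → Formula P
  | or : Formula P → Formula P → Formula P
  | imp : Formula P → Formula P → Formula P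
  | K : Formula P → Formula P
  | Kh : PL P → Formula P
  | box : Formula P → Formula P

/-- The inclusion of `PL` into `DELKh`. -/
def PL.toFormula {P : Type u} : PL P → Formula P
  | .atom p => .atom p
  | .bot => .bot
  | .and α β => .and α.toFormula β.toFormula
  | .or α β => .or α.toFormula β.toFormula
  | .imp α β => .imp α.toFormula β.toFormula

namespace Formula

variable {P : Type u}

/-- `¬ φ` abbreviates `φ → ⊥`. -/
def neg (φ : Formula P) : Formula P := φ.imp bot

/-- `⊤` abbreviates `¬ ⊥`. -/
def top : Formula P := neg bot

/-- `φ ↔ ψ` abbreviates `(φ → ψ) ∧ (ψ → φ)`. -/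
def iff (φ ψ : Formula P) : Formula P := (φ.imp ψ).and (ψ.imp φ)

/-- The dual `¬ K ¬` of `K`. -/
def Khat (φ : Formula P) : Formula P := neg (K (neg φ))

/-- The dual `¬ □ ¬` of `□`. -/
def dia (φ : Formula P) : Formula P := neg (box (neg φ))

/-- Finite conjunctions; the empty conjunction is `⊤`. -/
def bigAnd : List (Formula P) → Formula P
  | [] => top
  | φ :: l => φ.and (bigAnd l)

/-- Truth of a formula under the Boolean connectives, where the proposition letters and all the
formulas `K φ`, `Kh α`, `□ φ` get their truth values from `v`. -/
def BoolTrue (v : Formula P → Prop) : Formula P → Prop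
  | bot => False
  | and φ ψ => BoolTrue v φ ∧ BoolTrue v ψ
  | or φ ψ => BoolTrue v φ ∨ BoolTrue v ψ
  | imp φ ψ => BoolTrue v φ → BoolTrue v ψ
  | atom p => v (atom p)
  | K φ => v (K φ)
  | Kh α => v (Kh α)
  | box φ => v (box φ)

/-- Propositional tautologies of `DELKh`, i.e. the substitution instances in `DELKh` of the
classical propositional tautologies. -/
def Tautology (φ : Formula P) : Prop := ∀ v : Formula P → Prop, BoolTrue v φ

end Formula

open Formula in
/-- Provability in the Hilbert system `SDELKh`. -/
inductive Provable {P : Type u} : Formula P → Prop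
  | TAUT (φ : Formula P) : Tautology φ → Provable φ
  | distK (φ ψ : Formula P) : Provable ((K (φ.imp ψ)).imp ((K φ).imp (K ψ)))
  | TK (φ : Formula P) : Provable ((K φ).imp φ)
  | fourK (φ : Formula P) : Provable ((K φ).imp (K (K φ)))
  | fiveK (φ : Formula P) : Provable ((neg (K φ)).imp (K (neg (K φ))))
  | distBox (φ ψ : Formula P) : Provable ((box (φ.imp ψ)).imp ((box φ).imp (box ψ)))
  | TBox (φ : Formula P) : Provable ((box φ).imp φ)
  | fourBox (φ : Formula P) : Provable ((box φ).imp (box (box φ)))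
  | PR (φ : Formula P) : Provable ((K (box φ)).imp (box (K φ)))
  | Per (α : PL P) : Provable (α.toFormula.imp (box α.toFormula))
  | Ver (α : PL P) : Provable (α.toFormula.imp (dia (Kh α)))
  | KhK (α : PL P) : Provable ((Kh α).imp (K α.toFormula))
  | KKhp (p : P) : Provable ((K (atom p)).imp (Kh (PL.atom p)))
  | KhBot : Provable ((Kh PL.bot).iff bot)
  | KhOr (α β : PL P) : Provable ((Kh (α.or β)).iff ((Kh α).or (Kh β)))
  | KhAnd (α β : PL P) : Provable ((Kh (α.and β)).iff ((Kh α).and (Kh β)))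
  | KhImp (α β : PL P) : Provable ((Kh (α.imp β)).iff (K (box ((Kh α).imp (Kh β)))))
  | fourKh (α : PL P) : Provable ((Kh α).imp (K (Kh α)))
  | fiveKh (α : PL P) : Provable ((neg (Kh α)).imp (K (neg (Kh α))))
  | EU (α : PL P) (l : List (PL P)) : Provable
      ((α.toFormula.and (bigAnd (l.map fun β => Khat (α.toFormula.and β.toFormula)))).imp
        (dia ((K α.toFormula).and (bigAnd (l.map fun β => Khat β.toFormula)))))
  | MP (φ ψ : Formula P) : Provable φ → Provable (φ.imp ψ) → Provable ψ
  | necK (φ : Formula P) : Provable φ → Provable (K φ)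
  | necBox (φ : Formula P) : Provable φ → Provable (box φ)

/-! Gödel numbering of formulas: a formula is coded by the pair of a tag for its main
connective and the codes of its components. -/

theorem unpair_snd_lt {n k : ℕ} (h : n.unpair.1 = k + 1) : n.unpair.2 < n := by
  have h1 := Nat.add_le_pair n.unpair.1 n.unpair.2
  rw [Nat.pair_unpair] at h1
  omega

theorem unpair_snd_fst_lt {n k : ℕ} (h : n.unpair.1 = k + 1) : n.unpair.2.unpair.1 < n :=
  (Nat.unpair_left_le _).trans_lt (unpair_snd_lt h)

theorem unpair_snd_snd_lt {n k : ℕ} (h : n.unpair.1 = k + 1) : n.unpair.2.unpair.2 < n :=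
  (Nat.unpair_right_le _).trans_lt (unpair_snd_lt h)

section Coding

variable {P : Type u}

/-- The Gödel number of a propositional formula. -/
def PL.code [Encodable P] : PL P → ℕ
  | .atom p => Nat.pair 0 (Encodable.encode p)
  | .bot => Nat.pair 1 0
  | .and α β => Nat.pair 2 (Nat.pair α.code β.code)
  | .or α β => Nat.pair 3 (Nat.pair α.code β.code)
  | .imp α β => Nat.pair 4 (Nat.pair α.code β.code)

/-- Decoding of Gödel numbers of propositional formulas. -/
def PL.ofCode [Encodable P] (n : ℕ) : Option (PL P) :=
  match h : n.unpair.1 with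
  | 0 => (Encodable.decode n.unpair.2).map PL.atom
  | 1 => some PL.bot
  | 2 => Option.map₂ PL.and (PL.ofCode n.unpair.2.unpair.1) (PL.ofCode n.unpair.2.unpair.2)
  | 3 => Option.map₂ PL.or (PL.ofCode n.unpair.2.unpair.1) (PL.ofCode n.unpair.2.unpair.2)
  | 4 => Option.map₂ PL.imp (PL.ofCode n.unpair.2.unpair.1) (PL.ofCode n.unpair.2.unpair.2)
  | _ => none
termination_by n
decreasing_by
  all_goals first | exact unpair_snd_fst_lt h | exact unpair_snd_snd_lt h

theorem PL.ofCode_code [Encodable P] (α : PL P) : PL.ofCode α.code = some α := by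
  induction α with
  | atom p => rw [PL.ofCode]; split <;> simp_all [PL.code]
  | bot => rw [PL.ofCode]; split <;> simp_all [PL.code]
  | and α β h1 h2 => rw [PL.ofCode]; split <;> simp_all [PL.code]
  | or α β h1 h2 => rw [PL.ofCode]; split <;> simp_all [PL.code]
  | imp α β h1 h2 => rw [PL.ofCode]; split <;> simp_all [PL.code]

instance [Encodable P] : Encodable (PL P) where
  encode := PL.code
  decode := PL.ofCode
  encodek := PL.ofCode_code

/-- The Gödel number of a `DELKh` formula. -/
def Formula.code [Encodable P] : Formula P → ℕ
  | .atom p => Nat.pair 0 (Encodable.encode p)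
  | .bot => Nat.pair 1 0
  | .and φ ψ => Nat.pair 2 (Nat.pair φ.code ψ.code)
  | .or φ ψ => Nat.pair 3 (Nat.pair φ.code ψ.code)
  | .imp φ ψ => Nat.pair 4 (Nat.pair φ.code ψ.code)
  | .K φ => Nat.pair 5 φ.code
  | .Kh α => Nat.pair 6 α.code
  | .box φ => Nat.pair 7 φ.code

/-- Decoding of Gödel numbers of `DELKh` formulas. -/
def Formula.ofCode [Encodable P] (n : ℕ) : Option (Formula P) :=
  match h : n.unpair.1 with
  | 0 => (Encodable.decode n.unpair.2).map Formula.atom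
  | 1 => some Formula.bot
  | 2 => Option.map₂ Formula.and (Formula.ofCode n.unpair.2.unpair.1)
      (Formula.ofCode n.unpair.2.unpair.2)
  | 3 => Option.map₂ Formula.or (Formula.ofCode n.unpair.2.unpair.1)
      (Formula.ofCode n.unpair.2.unpair.2)
  | 4 => Option.map₂ Formula.imp (Formula.ofCode n.unpair.2.unpair.1)
      (Formula.ofCode n.unpair.2.unpair.2)
  | 5 => (Formula.ofCode n.unpair.2).map Formula.K
  | 6 => (PL.ofCode n.unpair.2).map Formula.Kh
  | 7 => (Formula.ofCode n.unpair.2).map Formula.box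
  | _ => none
termination_by n
decreasing_by
  all_goals first
    | exact unpair_snd_fst_lt h
    | exact unpair_snd_snd_lt h
    | exact unpair_snd_lt h

theorem Formula.ofCode_code [Encodable P] (φ : Formula P) :
    Formula.ofCode φ.code = some φ := by
  induction φ with
  | atom p => rw [Formula.ofCode]; split <;> simp_all [Formula.code]
  | bot => rw [Formula.ofCode]; split <;> simp_all [Formula.code]
  | and φ ψ h1 h2 => rw [Formula.ofCode]; split <;> simp_all [Formula.code]
  | or φ ψ h1 h2 => rw [Formula.ofCode]; split <;> simp_all [Formula.code]
  | imp φ ψ h1 h2 => rw [Formula.ofCode]; split <;> simp_all [Formula.code]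
  | K φ h => rw [Formula.ofCode]; split <;> simp_all [Formula.code]
  | Kh α => rw [Formula.ofCode]; split <;> simp_all [Formula.code, PL.ofCode_code]
  | box φ h => rw [Formula.ofCode]; split <;> simp_all [Formula.code]

instance [Encodable P] : Encodable (Formula P) where
  encode := Formula.code
  decode := Formula.ofCode
  encodek := Formula.ofCode_code

/-- Given the values `x`, `y` of an optional code (`0` for none, `c + 1` for the code `c`),
the optional code of the compound with tag `t`. -/
def comb₂ (t x y : ℕ) : ℕ :=
  if x = 0 ∨ y = 0 then 0 else Nat.pair t (Nat.pair (x - 1) (y - 1)) + 1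

/-- The unary version of `comb₂`. -/
def comb₁ (t x : ℕ) : ℕ := if x = 0 then 0 else Nat.pair t (x - 1) + 1

theorem primrec_comb₂ {α : Type*} [Primcodable α] (t : ℕ) {f g : α → ℕ} (hf : Primrec f)
    (hg : Primrec g) : Primrec fun a => comb₂ t (f a) (g a) := by
  unfold comb₂
  refine Primrec.ite (PrimrecPred.or (Primrec.eq.comp hf (Primrec.const 0))
    (Primrec.eq.comp hg (Primrec.const 0))) (Primrec.const 0) (Primrec.succ.comp ?_)
  exact Primrec₂.natPair.comp (Primrec.const t)
    (Primrec₂.natPair.comp (Primrec.pred.comp hf) (Primrec.pred.comp hg))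

theorem primrec_comb₁ {α : Type*} [Primcodable α] (t : ℕ) {f : α → ℕ} (hf : Primrec f) :
    Primrec fun a => comb₁ t (f a) := by
  unfold comb₁
  refine Primrec.ite (Primrec.eq.comp hf (Primrec.const 0)) (Primrec.const 0)
    (Primrec.succ.comp ?_)
  exact Primrec₂.natPair.comp (Primrec.const t) (Primrec.pred.comp hf)

theorem primrec_encode_decode (α : Type*) [Primcodable α] :
    Primrec fun n : ℕ => Encodable.encode (Encodable.decode (α := α) n) :=
  Primrec.nat_iff.2 (Primcodable.prim α)

/-- One step of the course-of-values recursion for `encode ∘ decode` on `PL`. -/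
def PL.step [Encodable P] (l : List ℕ) : ℕ :=
  let n := l.length
  let t := n.unpair.1
  let m := n.unpair.2
  let x := l.getD m.unpair.1 0
  let y := l.getD m.unpair.2 0
  if t = 0 then comb₁ 0 (Encodable.encode (Encodable.decode (α := P) m))
  else if t = 1 then Nat.pair 1 0 + 1
  else if t = 2 then comb₂ 2 x y
  else if t = 3 then comb₂ 3 x y
  else if t = 4 then comb₂ 4 x y
  else 0

/-- One step of the course-of-values recursion for `encode ∘ decode` on `Formula`. -/
def Formula.step [Encodable P] (l : List ℕ) : ℕ :=
  let n := l.length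
  let t := n.unpair.1
  let m := n.unpair.2
  let x := l.getD m.unpair.1 0
  let y := l.getD m.unpair.2 0
  if t = 0 then comb₁ 0 (Encodable.encode (Encodable.decode (α := P) m))
  else if t = 1 then Nat.pair 1 0 + 1
  else if t = 2 then comb₂ 2 x y
  else if t = 3 then comb₂ 3 x y
  else if t = 4 then comb₂ 4 x y
  else if t = 5 then comb₁ 5 (l.getD m 0)
  else if t = 6 then comb₁ 6 (Encodable.encode (Encodable.decode (α := PL P) m))
  else if t = 7 then comb₁ 7 (l.getD m 0)
  else 0

theorem PL.step_primrec [Primcodable P] : Primrec (PL.step (P := P)) := by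
  have hn : Primrec fun l : List ℕ => l.length := Primrec.list_length
  have hu : Primrec fun l : List ℕ => l.length.unpair := Primrec.unpair.comp hn
  have ht := Primrec.fst.comp hu
  have hm := Primrec.snd.comp hu
  have hx := (Primrec.list_getD 0).comp Primrec.id (Primrec.fst.comp (Primrec.unpair.comp hm))
  have hy := (Primrec.list_getD 0).comp Primrec.id (Primrec.snd.comp (Primrec.unpair.comp hm))
  have he (k : ℕ) := Primrec.eq.comp ht (Primrec.const k)
  exact Primrec.ite (he 0) (primrec_comb₁ 0 ((primrec_encode_decode P).comp hm))
    (Primrec.ite (he 1) (Primrec.const _) (Primrec.ite (he 2) (primrec_comb₂ 2 hx hy)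
    (Primrec.ite (he 3) (primrec_comb₂ 3 hx hy) (Primrec.ite (he 4) (primrec_comb₂ 4 hx hy)
    (Primrec.const 0)))))

theorem PL.step_spec [Encodable P] (n : ℕ) :
    PL.step (P := P) ((List.range n).map fun k => Encodable.encode (PL.ofCode (P := P) k)) =
      Encodable.encode (PL.ofCode (P := P) n) := by
  have key : ∀ k, k < n → ((List.range n).map fun k =>
      Encodable.encode (PL.ofCode (P := P) k)).getD k 0 =
        Encodable.encode (PL.ofCode (P := P) k) := by
    intro k hk
    simp [List.getD, hk]
  have c2 (f : PL P → PL P → PL P) (t : ℕ)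
      (hf : ∀ α β, (f α β).code = Nat.pair t (Nat.pair α.code β.code)) (a b : Option (PL P)) :
      comb₂ t (Encodable.encode a) (Encodable.encode b) =
        Encodable.encode (Option.map₂ f a b) := by
    rcases a with _ | a <;> rcases b with _ | b <;> simp [comb₂]
    exact (hf a b).symm
  rw [PL.ofCode]
  split <;> rename_i h <;> rw [PL.step] <;> simp only [List.length_map, List.length_range]
  · rw [h]
    rcases Encodable.decode (α := P) n.unpair.2 with _ | a
    · simp [comb₁]
    · simp [comb₁]; rfl
  · rw [h]; simp; rfl
  · rw [h, key _ (unpair_snd_fst_lt h), key _ (unpair_snd_snd_lt h)]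
    simpa using c2 _ _ (fun _ _ => rfl) _ _
  · rw [h, key _ (unpair_snd_fst_lt h), key _ (unpair_snd_snd_lt h)]
    simpa using c2 _ _ (fun _ _ => rfl) _ _
  · rw [h, key _ (unpair_snd_fst_lt h), key _ (unpair_snd_snd_lt h)]
    simpa using c2 _ _ (fun _ _ => rfl) _ _
  · simp_all

instance [Primcodable P] : Primcodable (PL P) where
  prim := by
    refine Primrec.nat_iff.1 ?_
    have := Primrec.nat_strong_rec
      (fun (_ : Unit) n => Encodable.encode (PL.ofCode (P := P) n))
      (g := fun _ l => some (PL.step (P := P) l))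
      (Primrec.option_some.comp (PL.step_primrec.comp Primrec.snd))
      (fun _ n => congrArg some (PL.step_spec n))
    exact this.comp (Primrec.const ()) Primrec.id

theorem Formula.step_primrec [Primcodable P] : Primrec (Formula.step (P := P)) := by
  have hn : Primrec fun l : List ℕ => l.length := Primrec.list_length
  have hu : Primrec fun l : List ℕ => l.length.unpair := Primrec.unpair.comp hn
  have ht := Primrec.fst.comp hu
  have hm := Primrec.snd.comp hu
  have hx := (Primrec.list_getD 0).comp Primrec.id (Primrec.fst.comp (Primrec.unpair.comp hm))
  have hy := (Primrec.list_getD 0).comp Primrec.id (Primrec.snd.comp (Primrec.unpair.comp hm))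
  have hz := (Primrec.list_getD 0).comp Primrec.id hm
  have he (k : ℕ) := Primrec.eq.comp ht (Primrec.const k)
  exact Primrec.ite (he 0) (primrec_comb₁ 0 ((primrec_encode_decode P).comp hm))
    (Primrec.ite (he 1) (Primrec.const _) (Primrec.ite (he 2) (primrec_comb₂ 2 hx hy)
    (Primrec.ite (he 3) (primrec_comb₂ 3 hx hy) (Primrec.ite (he 4) (primrec_comb₂ 4 hx hy)
    (Primrec.ite (he 5) (primrec_comb₁ 5 hz)
    (Primrec.ite (he 6) (primrec_comb₁ 6 ((primrec_encode_decode (PL P)).comp hm))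
    (Primrec.ite (he 7) (primrec_comb₁ 7 hz) (Primrec.const 0))))))))

theorem Formula.step_spec [Encodable P] (n : ℕ) :
    Formula.step (P := P)
        ((List.range n).map fun k => Encodable.encode (Formula.ofCode (P := P) k)) =
      Encodable.encode (Formula.ofCode (P := P) n) := by
  have key : ∀ k, k < n → ((List.range n).map fun k =>
      Encodable.encode (Formula.ofCode (P := P) k)).getD k 0 =
        Encodable.encode (Formula.ofCode (P := P) k) := by
    intro k hk
    simp [List.getD, hk]
  have c2 (f : Formula P → Formula P → Formula P) (t : ℕ)
      (hf : ∀ α β, (f α β).code = Nat.pair t (Nat.pair α.code β.code))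
      (a b : Option (Formula P)) :
      comb₂ t (Encodable.encode a) (Encodable.encode b) =
        Encodable.encode (Option.map₂ f a b) := by
    rcases a with _ | a <;> rcases b with _ | b <;> simp [comb₂]
    exact (hf a b).symm
  have c1 (f : Formula P → Formula P) (t : ℕ)
      (hf : ∀ α, (f α).code = Nat.pair t α.code) (a : Option (Formula P)) :
      comb₁ t (Encodable.encode a) = Encodable.encode (Option.map f a) := by
    rcases a with _ | a <;> simp [comb₁]
    exact (hf a).symm
  rw [Formula.ofCode]
  split <;> rename_i h <;> rw [Formula.step] <;> simp only [List.length_map, List.length_range]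
  · rw [h]
    rcases Encodable.decode (α := P) n.unpair.2 with _ | a
    · simp [comb₁]
    · simp [comb₁]; rfl
  · rw [h]; simp; rfl
  · rw [h, key _ (unpair_snd_fst_lt h), key _ (unpair_snd_snd_lt h)]
    simpa using c2 _ _ (fun _ _ => rfl) _ _
  · rw [h, key _ (unpair_snd_fst_lt h), key _ (unpair_snd_snd_lt h)]
    simpa using c2 _ _ (fun _ _ => rfl) _ _
  · rw [h, key _ (unpair_snd_fst_lt h), key _ (unpair_snd_snd_lt h)]
    simpa using c2 _ _ (fun _ _ => rfl) _ _
  · rw [h, key _ (unpair_snd_lt h)]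
    simpa using c1 _ _ (fun _ => rfl) _
  · rw [h]
    change _ = Encodable.encode (Option.map Formula.Kh (Encodable.decode n.unpair.2))
    rcases Encodable.decode (α := PL P) n.unpair.2 with _ | a
    · simp [comb₁]
    · simp [comb₁]; rfl
  · rw [h, key _ (unpair_snd_lt h)]
    simpa using c1 _ _ (fun _ => rfl) _
  · simp_all

instance [Primcodable P] : Primcodable (Formula P) where
  prim := by
    refine Primrec.nat_iff.1 ?_
    have := Primrec.nat_strong_rec
      (fun (_ : Unit) n => Encodable.encode (Formula.ofCode (P := P) n))
      (g := fun _ l => some (Formula.step (P := P) l))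
      (Primrec.option_some.comp (Formula.step_primrec.comp Primrec.snd))
      (fun _ n => congrArg some (Formula.step_spec n))
    exact this.comp (Primrec.const ()) Primrec.id

end Coding

end SDELKh

/-! The system is sound for pairs of an information state `s` and a world `w ∈ s`: `K` ranges over
`s`, `□` over the substates of `s` that still contain `w`, and `Kh α` is inquisitive support of `α`
at `s`. No canonical model is needed for the converse, because over finitely many letters each
finite pointed state has a description inside the language (`pointed`): `K` of the disjunction of
its worlds' literal descriptions, `Khat` of each of them, and the description of the actual world.

The core is that a description provably settles every formula over its letters, with the semantic
answer (`Formula.pointed_decides`, and `PL.stateForm_decides_Kh` for know-how). `K` is handled by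
introspection. A positive `□` holds because propositional facts and knowledge of them persist, so a
later state can only be a substate (`K_cover_imp`, `pointed_imp_box`). A negative `□` holds because
`EU` makes every substate around the actual world reachable (`pointed_imp_not_box`).

If the worlds realize all valuations of the letters, the system proves that one of the finitely many
descriptions holds, so a formula true at all of them is provable (`Provable.of_sat`). Provability is
thus truth at finitely many pairs (`provable_iff`). With worlds and states coded by the bits of
numbers, the check is bounded by a primitive recursive function of the code of the formula and is
itself primitive recursive. -/

namespace SDELKh

open Formula

/-! ### State semantics and soundness. -/

section Semantics

variable {P W : Type*}

/-- Classical truth of a propositional formula at a world. -/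
def PL.Eval (V : W → P → Prop) (w : W) : PL P → Prop
  | .atom p => V w p
  | .bot => False
  | .and α β => α.Eval V w ∧ β.Eval V w
  | .or α β => α.Eval V w ∨ β.Eval V w
  | .imp α β => α.Eval V w → β.Eval V w

/-- Inquisitive support of a propositional formula at a nonempty information state. -/
def PL.Supp (V : W → P → Prop) : PL P → Set W → Prop
  | .atom p, s => ∀ w ∈ s, V w p
  | .bot, _ => False
  | .and α β, s => α.Supp V s ∧ β.Supp V s
  | .or α β, s => α.Supp V s ∨ β.Supp V s
  | .imp α β, s => ∀ t ⊆ s, t.Nonempty → α.Supp V t → β.Supp V t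

/-- Truth of a `DELKh` formula at a world of an information state: `K` quantifies over the worlds
of the state and `□` over the substates that contain the actual world. -/
def Formula.Sat (V : W → P → Prop) : Formula P → Set W → W → Prop
  | .atom p, _, w => V w p
  | .bot, _, _ => False
  | .and φ ψ, s, w => φ.Sat V s w ∧ ψ.Sat V s w
  | .or φ ψ, s, w => φ.Sat V s w ∨ ψ.Sat V s w
  | .imp φ ψ, s, w => φ.Sat V s w → ψ.Sat V s w
  | .K φ, s, _ => ∀ v ∈ s, φ.Sat V s v
  | .Kh α, s, _ => α.Supp V s
  | .box φ, s, w => ∀ t ⊆ s, w ∈ t → φ.Sat V t w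

variable {V : W → P → Prop}

theorem PL.sat_toFormula (α : PL P) (s : Set W) (w : W) :
    α.toFormula.Sat V s w ↔ α.Eval V w := by
  induction α <;> simp_all [PL.toFormula, Formula.Sat, PL.Eval]

theorem PL.Supp.mono {α : PL P} {s t : Set W} (h : α.Supp V s) (hts : t ⊆ s) :
    α.Supp V t := by
  induction α with
  | atom p => exact fun w hw => h w (hts hw)
  | bot => exact h
  | and α β ha hb => exact ⟨ha h.1, hb h.2⟩
  | or α β ha hb => exact h.imp ha hb
  | imp α β ha hb => exact fun u hu => h u (hu.trans hts)

/-- A singleton is its only nonempty substate, so the inquisitive implication collapses to the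
classical one. Combined with persistence, this makes know-how factive. -/
theorem PL.supp_singleton (α : PL P) (w : W) : α.Supp V {w} ↔ α.Eval V w := by
  induction α with
  | imp α β ha hb =>
    simp only [PL.Supp, PL.Eval, ← ha, ← hb]
    refine ⟨fun h => h _ subset_rfl (Set.singleton_nonempty w), fun h t ht hn => ?_⟩
    rwa [(Set.Nonempty.subset_singleton_iff hn).1 ht]
  | _ => simp_all [PL.Supp, PL.Eval]

theorem PL.Supp.eval {α : PL P} {s : Set W} (h : α.Supp V s) {w : W} (hw : w ∈ s) :
    α.Eval V w :=
  (α.supp_singleton w).1 (h.mono (Set.singleton_subset_iff.2 hw))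

theorem Formula.boolTrue_sat (φ : Formula P) (s : Set W) (w : W) :
    BoolTrue (fun ψ => ψ.Sat V s w) φ ↔ φ.Sat V s w := by
  induction φ <;> simp_all [BoolTrue, Formula.Sat]

theorem Formula.sat_bigAnd (l : List (Formula P)) (s : Set W) (w : W) :
    (bigAnd l).Sat V s w ↔ ∀ φ ∈ l, φ.Sat V s w := by
  induction l <;> simp_all [bigAnd, Formula.Sat, top, neg]

/-- Soundness of `SDELKh`. -/
theorem Provable.sat {φ : Formula P} (h : Provable φ) :
    ∀ (s : Set W) (w : W), w ∈ s → φ.Sat V s w := by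
  induction h with
  | TAUT φ h => exact fun s w _ => (φ.boolTrue_sat s w).1 (h _)
  | MP φ ψ _ _ h1 h2 => exact fun s w hw => h2 s w hw (h1 s w hw)
  | necK φ _ h => exact fun s _ _ v hv => h s v hv
  | necBox φ _ h => exact fun _ w _ t _ hw => h t w hw
  | distK φ ψ => exact fun s w _ h1 h2 v hv => h1 v hv (h2 v hv)
  | TK φ => exact fun s w hw h => h w hw
  | fourK φ => exact fun s w _ h _ _ => h
  | fiveK φ => exact fun s w _ h _ _ => h
  | distBox φ ψ => exact fun s w _ h1 h2 t ht hw => h1 t ht hw (h2 t ht hw)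
  | TBox φ => exact fun s w hw h => h s subset_rfl hw
  | fourBox φ => exact fun s w _ h t ht _ u hu => h u (hu.trans ht)
  | PR φ => exact fun s w _ h t ht _ v hv => h v (ht hv) t ht hv
  | Per α =>
    intro s w _ h t _ _
    rw [PL.sat_toFormula] at h ⊢
    exact h
  | Ver α =>
    intro s w hw h hn
    rw [PL.sat_toFormula] at h
    -- Shrinking to the actual world alone turns truth into support.
    exact hn {w} (Set.singleton_subset_iff.2 hw) rfl ((α.supp_singleton w).2 h)
  | KhK α => exact fun s w _ h v hv => (α.sat_toFormula s v).2 (PL.Supp.eval h hv)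
  | KKhp p => exact fun s w _ h => h
  | KhBot => exact fun s w _ => ⟨id, id⟩
  | KhOr α β => exact fun s w _ => ⟨id, id⟩
  | KhAnd α β => exact fun s w _ => ⟨id, id⟩
  | KhImp α β =>
    exact fun s w _ => ⟨fun h v _ t ht hvt => h t ht ⟨v, hvt⟩,
      fun h t ht ⟨v, hvt⟩ => h v (ht hvt) t ht hvt⟩
  | fourKh α => exact fun s w _ h _ _ => h
  | fiveKh α => exact fun s w _ h _ _ => h
  | EU α l =>
    rintro s w hw ⟨h1, h2⟩ hn
    rw [PL.sat_toFormula] at h1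
    rw [sat_bigAnd] at h2
    -- The witness is the update of `s` with `α`; every `α`-world survives it, hence so do the
    -- promised possibilities.
    refine hn {v ∈ s | α.Eval V v} (Set.sep_subset _ _) ⟨hw, h1⟩ ⟨fun v hv => ?_, ?_⟩
    · exact (α.sat_toFormula _ v).2 hv.2
    · rw [sat_bigAnd]
      intro φ hφ
      obtain ⟨β, hβ, rfl⟩ := List.mem_map.1 hφ
      intro hb
      refine h2 _ (List.mem_map.2 ⟨β, hβ, rfl⟩) fun v hv hab => ?_
      have hab' : _ ∧ _ := hab
      rw [PL.sat_toFormula, PL.sat_toFormula] at hab'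
      exact hb v ⟨hv, hab'.1⟩ ((β.sat_toFormula _ v).2 hab'.2)

end Semantics

/-! ### Propositional and normal modal reasoning inside the system. -/

section Derivations

variable {P : Type*} {φ ψ χ : Formula P}

/-- Replaces Hilbert-style propositional derivations by a check on Boolean valuations; the premises
are discharged one at a time by modus ponens. -/
theorem Provable.of_taut (Γ : List (Formula P)) (hΓ : ∀ γ ∈ Γ, Provable γ)
    (h : ∀ v, (∀ γ ∈ Γ, BoolTrue v γ) → BoolTrue v φ) : Provable φ := by
  induction Γ generalizing φ with
  | nil => exact .TAUT φ fun v => h v (by simp)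
  | cons γ Γ ih =>
    refine .MP γ φ (hΓ γ (by simp)) (ih (fun δ hδ => hΓ δ (by simp [hδ])) fun v hv hγ => ?_)
    exact h v (by simpa using ⟨hγ, hv⟩)

theorem Provable.of_taut₁ {γ : Formula P} (h₁ : Provable γ)
    (h : ∀ v, BoolTrue v γ → BoolTrue v φ) : Provable φ :=
  .of_taut [γ] (by simpa) (by simpa)

theorem Provable.of_taut₂ {γ δ : Formula P} (h₁ : Provable γ) (h₂ : Provable δ)
    (h : ∀ v, BoolTrue v γ → BoolTrue v δ → BoolTrue v φ) : Provable φ :=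
  .of_taut [γ, δ] (by simp [h₁, h₂]) (by simpa)

theorem Provable.of_taut₃ {γ δ ε : Formula P} (h₁ : Provable γ) (h₂ : Provable δ)
    (h₃ : Provable ε) (h : ∀ v, BoolTrue v γ → BoolTrue v δ → BoolTrue v ε → BoolTrue v φ) :
    Provable φ :=
  .of_taut [γ, δ, ε] (by simp [h₁, h₂, h₃]) (by simpa)

theorem Provable.trans (h₁ : Provable (φ.imp ψ)) (h₂ : Provable (ψ.imp χ)) :
    Provable (φ.imp χ) :=
  .of_taut₂ h₁ h₂ fun _ h₁ h₂ h => h₂ (h₁ h)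

theorem Formula.boolTrue_bigAnd (v : Formula P → Prop) (l : List (Formula P)) :
    BoolTrue v (bigAnd l) ↔ ∀ φ ∈ l, BoolTrue v φ := by
  induction l <;> simp_all [bigAnd, BoolTrue, top, neg]

@[simp] theorem Formula.boolTrue_neg (v : Formula P → Prop) (φ : Formula P) :
    BoolTrue v (neg φ) ↔ ¬ BoolTrue v φ := Iff.rfl

theorem Provable.imp_bigAnd {l : List (Formula P)} (h : ∀ ψ ∈ l, Provable (φ.imp ψ)) :
    Provable (φ.imp (bigAnd l)) := by
  refine .of_taut (l.map φ.imp) (by simpa using h) fun v hv hφ => ?_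
  rw [boolTrue_bigAnd]
  exact fun ψ hψ => hv _ (List.mem_map_of_mem hψ) hφ

theorem Provable.modal_intro (M : Formula P → Formula P)
    (nec : ∀ φ, Provable φ → Provable (M φ))
    (dist : ∀ φ ψ, Provable ((M (φ.imp ψ)).imp ((M φ).imp (M ψ))))
    (Γ : List (Formula P)) (hχ : ∀ γ ∈ Γ, Provable (χ.imp (M γ)))
    (h : Provable ((bigAnd Γ).imp φ)) : Provable (χ.imp (M φ)) := by
  induction Γ generalizing φ with
  | nil =>
    have h' : Provable φ := h.of_taut₁ fun v hv => hv fun h => h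
    exact (nec φ h').of_taut₁ fun v hv _ => hv
  | cons γ Γ ih =>
    have h' : Provable (χ.imp (M (γ.imp φ))) :=
      ih (fun δ hδ => hχ δ (by simp [hδ])) (h.of_taut₁ fun v hv h₁ h₂ => hv ⟨h₂, h₁⟩)
    exact .of_taut₃ h' (hχ γ (by simp)) (dist γ φ) fun v h₁ h₂ h₃ h => h₃ (h₁ h) (h₂ h)

theorem Provable.K_intro (Γ : List (Formula P)) (hχ : ∀ γ ∈ Γ, Provable (χ.imp (K γ)))
    (h : Provable ((bigAnd Γ).imp φ)) : Provable (χ.imp (K φ)) :=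
  .modal_intro K .necK .distK Γ hχ h

theorem Provable.box_intro (Γ : List (Formula P)) (hχ : ∀ γ ∈ Γ, Provable (χ.imp (box γ)))
    (h : Provable ((bigAnd Γ).imp φ)) : Provable (χ.imp (box φ)) :=
  .modal_intro box .necBox .distBox Γ hχ h

theorem Provable.K_mono (h : Provable (φ.imp ψ)) : Provable ((K φ).imp (K ψ)) :=
  .K_intro [φ] (by simpa using .TAUT _ fun _ h => h) (h.of_taut₁ fun _ h h₁ => h h₁.1)

theorem Provable.Khat_mono (h : Provable (φ.imp ψ)) : Provable ((Khat φ).imp (Khat ψ)) :=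
  (K_mono (h.of_taut₁ (φ := (neg ψ).imp (neg φ)) fun _ h h₁ h₂ => h₁ (h h₂))).of_taut₁
    fun _ h h₁ h₂ => h₁ (h h₂)

theorem Provable.imp_Khat (φ : Formula P) : Provable (φ.imp (Khat φ)) :=
  (Provable.TK (neg φ)).of_taut₁ fun _ h h₁ h₂ => h h₂ h₁

end Derivations

/-! ### Characteristic formulas of finite pointed states. -/

section Descriptions

variable {P W : Type*} (V : W → P → Prop) (A : List P)

/-- Finite disjunctions of propositional formulas. -/
def PL.bigOr : List (PL P) → PL P
  | [] => .bot
  | α :: l => α.or (bigOr l)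

/-- Finite conjunctions of propositional formulas. -/
def PL.bigAnd : List (PL P) → PL P
  | [] => .imp .bot .bot
  | α :: l => α.and (bigAnd l)

theorem PL.boolTrue_bigOr (v : Formula P → Prop) (l : List (PL P)) :
    BoolTrue v (PL.bigOr l).toFormula ↔ ∃ α ∈ l, BoolTrue v α.toFormula := by
  induction l <;> simp_all [PL.bigOr, PL.toFormula, BoolTrue]

theorem PL.boolTrue_bigAnd (v : Formula P → Prop) (l : List (PL P)) :
    BoolTrue v (PL.bigAnd l).toFormula ↔ ∀ α ∈ l, BoolTrue v α.toFormula := by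
  induction l <;> simp_all [PL.bigAnd, PL.toFormula, BoolTrue]

open Classical in
/-- The description of a world by literals over the letters in `A`. -/
noncomputable def desc (w : W) : PL P :=
  PL.bigAnd (A.map fun p => if V w p then .atom p else (PL.atom p).imp .bot)

/-- The disjunction of the descriptions of the worlds in `s`. -/
noncomputable def cover (s : Finset W) : PL P :=
  PL.bigOr (s.toList.map (desc V A))

/-- The description of the information state `s`. -/
noncomputable def stateForm (s : Finset W) : Formula P :=
  (K (cover V A s).toFormula).and (bigAnd (s.toList.map fun w => Khat (desc V A w).toFormula))

/-- The description of the information state `s` with actual world `w`. -/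
noncomputable def pointed (s : Finset W) (w : W) : Formula P :=
  (stateForm V A s).and (desc V A w).toFormula

variable {V A}

theorem boolTrue_desc (v : Formula P → Prop) (w : W) :
    BoolTrue v (desc V A w).toFormula ↔ ∀ p ∈ A, (V w p ↔ v (.atom p)) := by
  simp only [desc, PL.boolTrue_bigAnd, List.mem_map, forall_exists_index, and_imp,
    forall_apply_eq_imp_iff₂]
  refine forall₂_congr fun p _ => ?_
  split_ifs with h <;> simp [PL.toFormula, BoolTrue, h]

theorem boolTrue_cover (v : Formula P → Prop) (s : Finset W) :
    BoolTrue v (cover V A s).toFormula ↔ ∃ w ∈ s, BoolTrue v (desc V A w).toFormula := by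
  simp [cover, PL.boolTrue_bigOr]

theorem boolTrue_stateForm (v : Formula P → Prop) (s : Finset W) :
    BoolTrue v (stateForm V A s) ↔ v (K (cover V A s).toFormula) ∧
      ∀ w ∈ s, ¬ v (K (neg (desc V A w).toFormula)) := by
  simp [stateForm, BoolTrue, boolTrue_bigAnd, Khat]

/-- Positive introspection covers the `K` conjunct, negative introspection the `Khat` conjuncts. -/
theorem stateForm_imp_K_stateForm (s : Finset W) :
    Provable ((stateForm V A s).imp (K (stateForm V A s))) := by
  refine .K_intro (K (cover V A s).toFormula ::
    s.toList.map fun w => Khat (desc V A w).toFormula) ?_ (.TAUT _ fun v h => h)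
  simp only [List.mem_cons, List.mem_map, Finset.mem_toList]
  rintro γ (rfl | ⟨w, hw, rfl⟩)
  · exact (Provable.fourK _).of_taut₁ fun v h h' => h h'.1
  · exact (Provable.fiveK _).of_taut₁ fun v h h' =>
      h (((boolTrue_stateForm v s).1 h').2 w hw)

/-- Under `K` both the state description and its cover are available, and the cover allows a case
split on the worlds of `s`. -/
theorem stateForm_imp_K {s : Finset W} {φ : Formula P}
    (h : ∀ w ∈ s, Provable ((pointed V A s w).imp φ)) :
    Provable ((stateForm V A s).imp (K φ)) := by
  refine .K_intro [stateForm V A s, (cover V A s).toFormula] ?_ ?_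
  · simp only [List.mem_cons, List.not_mem_nil, or_false]
    rintro γ (rfl | rfl)
    · exact stateForm_imp_K_stateForm s
    · exact .TAUT _ fun v h => h.1
  · refine .of_taut (s.toList.map fun w => (pointed V A s w).imp φ) (by simpa using h) ?_
    rintro v hv ⟨h₁, h₂, -⟩
    obtain ⟨w, hw, hd⟩ := (boolTrue_cover v s).1 h₂
    exact hv _ (List.mem_map.2 ⟨w, by simpa using hw, rfl⟩) ⟨h₁, hd⟩

/-- Knowing `φ` along with the state description would rule out `w`, which the description declares
possible. -/
theorem stateForm_imp_not_K {s : Finset W} {φ : Formula P} {w : W} (hw : w ∈ s)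
    (h : Provable ((pointed V A s w).imp (neg φ))) :
    Provable ((stateForm V A s).imp (neg (K φ))) := by
  have key : Provable (((stateForm V A s).and (K φ)).imp (K (neg (desc V A w).toFormula))) := by
    refine .K_intro [stateForm V A s, φ] ?_ (h.of_taut₁ fun v h h₁ h₂ =>
      h ⟨h₁.1, h₂⟩ h₁.2.1)
    simp only [List.mem_cons, List.not_mem_nil, or_false]
    rintro γ (rfl | rfl)
    · exact (stateForm_imp_K_stateForm s).of_taut₁ fun v h h' => h h'.1
    · exact .TAUT _ fun v h => h.2
  exact key.of_taut₁ fun v h h₁ h₂ => ((boolTrue_stateForm v s).1 h₁).2 w hw (h ⟨h₁, h₂⟩)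

/-- If only worlds of `s` are considered possible, the current state is some substate of `s`. -/
theorem K_cover_imp {s : Finset W} {φ : Formula P} {w : W} (hw : w ∈ s)
    (h : ∀ t ⊆ s, w ∈ t → Provable ((pointed V A t w).imp φ)) :
    Provable (((K (cover V A s).toFormula).and (desc V A w).toFormula).imp φ) := by
  classical
  -- `Q t` says that the worlds of `s` outside `t` are known not to be actual, which narrows the
  -- known cover from `s` to `t`.
  let Q (t : Finset W) : Formula P := bigAnd (K (cover V A s).toFormula ::
    (s \ t).toList.map fun u => K (neg (desc V A u).toFormula))
  have hQ (t : Finset W) : Provable ((Q t).imp (K (cover V A t).toFormula)) := by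
    refine .K_intro ((cover V A s).toFormula ::
      (s \ t).toList.map fun u => neg (desc V A u).toFormula) ?_ ?_
    · intro γ hγ
      refine .TAUT _ fun v hv => (boolTrue_bigAnd v _).1 hv _ ?_
      simp only [List.mem_cons, List.mem_map] at hγ ⊢
      rcases hγ with rfl | ⟨u, hu, rfl⟩
      · exact .inl rfl
      · exact .inr ⟨u, hu, rfl⟩
    · refine .TAUT _ ?_
      rintro v ⟨h₁, h₂⟩
      rw [boolTrue_bigAnd] at h₂
      obtain ⟨u, hu, hd⟩ := (boolTrue_cover v s).1 h₁
      refine (boolTrue_cover v t).2 ⟨u, ?_, hd⟩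
      by_contra hut
      exact h₂ _ (List.mem_map.2 ⟨u, by simp [hu, hut], rfl⟩) hd
  refine .of_taut ((desc V A w).toFormula.imp (Khat (desc V A w).toFormula) ::
    (s.powerset.toList.map fun t => (Q t).imp (K (cover V A t).toFormula)) ++
    ({t ∈ s.powerset | w ∈ t}.toList.map fun t => (pointed V A t w).imp φ)) ?_ ?_
  · simp only [List.cons_append, List.mem_cons, List.mem_append, List.mem_map, Finset.mem_toList,
      Finset.mem_filter, Finset.mem_powerset]
    rintro γ (rfl | ⟨t, ht, rfl⟩ | ⟨t, ht, rfl⟩)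
    · exact .imp_Khat _
    · exact hQ t
    · exact h t ht.1 ht.2
  · rintro v hv ⟨hK, hd⟩
    simp only [List.cons_append, List.mem_cons, List.mem_append, List.mem_map, Finset.mem_toList,
      Finset.mem_filter, Finset.mem_powerset] at hv
    -- For a given Boolean valuation the right substate consists of the worlds it does not exclude;
    -- `w` is among them because its description is true.
    let t := {u ∈ s | ¬ v (K (neg (desc V A u).toFormula))}
    have hts : t ⊆ s := Finset.filter_subset _ _
    have hwt : w ∈ t := Finset.mem_filter.2 ⟨hw, fun hn => hv _ (.inl rfl) hd hn⟩
    refine hv _ (.inr (.inr ⟨t, ⟨hts, hwt⟩, rfl⟩)) ⟨(boolTrue_stateForm v t).2 ⟨?_, ?_⟩, hd⟩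
    · refine hv _ (.inr (.inl ⟨t, hts, rfl⟩)) ((boolTrue_bigAnd v _).2 ?_)
      simp only [List.mem_cons, List.mem_map, Finset.mem_toList, Finset.mem_sdiff]
      rintro γ (rfl | ⟨u, ⟨hu, hut⟩, rfl⟩)
      · exact hK
      · by_contra hn
        exact hut (Finset.mem_filter.2 ⟨hu, hn⟩)
    · exact fun u hu => (Finset.mem_filter.1 hu).2

/-- Persistence of `α` under `K`, followed by exchanging `K` and `□`. -/
theorem K_toFormula_imp_box (α : PL P) :
    Provable ((K α.toFormula).imp (box (K α.toFormula))) :=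
  (Provable.Per α).K_mono.trans (.PR _)

/-- The `Khat` conjuncts may be lost under `□`; only the known cover and the actual world's
description persist. That is exactly the premise of `K_cover_imp`, hence the quantification over all
substates containing `w`. -/
theorem pointed_imp_box {s : Finset W} {φ : Formula P} {w : W} (hw : w ∈ s)
    (h : ∀ t ⊆ s, w ∈ t → Provable ((pointed V A t w).imp φ)) :
    Provable ((pointed V A s w).imp (box φ)) := by
  refine .box_intro [K (cover V A s).toFormula, (desc V A w).toFormula] ?_
    ((K_cover_imp hw h).of_taut₁ fun v h h' => h ⟨h'.1, h'.2.1⟩)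
  simp only [List.mem_cons, List.not_mem_nil, or_false]
  rintro γ (rfl | rfl)
  · exact (K_toFormula_imp_box _).of_taut₁ fun v h h' => h h'.1.1
  · exact (Provable.Per _).of_taut₁ fun v h h' => h h'.2

/-- `EU`, applied to the cover of `t` and the descriptions of its worlds, yields `◇` of the state
description of `t`. By contrast `□ φ` would give `□` of its negation, as `φ` fails at `t` with
actual world `w`. -/
theorem pointed_imp_not_box {s t : Finset W} {φ : Formula P} {w : W} (hts : t ⊆ s) (hw : w ∈ t)
    (h : Provable ((pointed V A t w).imp (neg φ))) :
    Provable ((pointed V A s w).imp (neg (box φ))) := by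
  have hbox : Provable (((box φ).and (desc V A w).toFormula).imp
      (box (neg (stateForm V A t)))) := by
    refine .box_intro [φ, (desc V A w).toFormula] ?_ (h.of_taut₁ fun v h h₁ h₂ =>
      h ⟨h₂, h₁.2.1⟩ h₁.1)
    simp only [List.mem_cons, List.not_mem_nil, or_false]
    rintro γ (rfl | rfl)
    · exact .TAUT _ fun v h => h.1
    · exact (Provable.Per _).of_taut₁ fun v h h' => h h'.2
  have hpre : Provable ((pointed V A s w).imp (bigAnd ((t.toList.map (desc V A)).map fun β =>
      Khat ((cover V A t).toFormula.and β.toFormula)))) := by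
    refine .imp_bigAnd ?_
    simp only [List.map_map, List.mem_map, Finset.mem_toList, Function.comp]
    rintro γ ⟨u, hu, rfl⟩
    -- For `u ∈ t` the description already implies the cover, so its possibility in `s` yields the
    -- stronger possibility that `EU` asks for.
    have hu' : Provable ((desc V A u).toFormula.imp
        ((cover V A t).toFormula.and (desc V A u).toFormula)) :=
      .TAUT _ fun v hv => ⟨(boolTrue_cover v t).2 ⟨u, hu, hv⟩, hv⟩
    exact hu'.Khat_mono.of_taut₁ fun v h h' =>
      h (((boolTrue_stateForm v s).1 h'.1).2 u (hts hu))
  have hEU := Provable.EU (cover V A t) (t.toList.map (desc V A))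
  have hst : (K (cover V A t).toFormula).and (bigAnd ((t.toList.map (desc V A)).map fun β =>
      Khat β.toFormula)) = stateForm V A t := by
    rw [stateForm, List.map_map]
    rfl
  rw [hst] at hEU
  refine .of_taut₃ hbox hpre hEU fun v h₁ h₂ h₃ h₄ h₅ => ?_
  exact h₃ ⟨(boolTrue_cover v t).2 ⟨w, hw, h₄.2⟩, h₂ h₄⟩ (h₁ ⟨h₅, h₄.2⟩)

/-! ### Descriptions decide all formulas over their letters; completeness. -/

/-- The letters of a propositional formula belong to `S`. -/
def PL.Over (S : Set P) : PL P → Prop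
  | .atom p => p ∈ S
  | .bot => True
  | .and α β => α.Over S ∧ β.Over S
  | .or α β => α.Over S ∧ β.Over S
  | .imp α β => α.Over S ∧ β.Over S

/-- The letters of a `DELKh` formula belong to `S`. -/
def Formula.Over (S : Set P) : Formula P → Prop
  | .atom p => p ∈ S
  | .bot => True
  | .and φ ψ => φ.Over S ∧ ψ.Over S
  | .or φ ψ => φ.Over S ∧ ψ.Over S
  | .imp φ ψ => φ.Over S ∧ ψ.Over S
  | .K φ => φ.Over S
  | .Kh α => α.Over S
  | .box φ => φ.Over S

theorem exists_finset_subset {s : Finset W} {t : Set W} (h : t ⊆ s) :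
    ∃ t' : Finset W, t' ⊆ s ∧ (t' : Set W) = t := by
  obtain ⟨t', rfl⟩ := (s.finite_toSet.subset h).exists_finset_coe
  exact ⟨t', Finset.coe_subset.1 h, rfl⟩

/-- The know-how axioms mirror the support clauses. For implication, `K □` ranges over pairs of a
substate and a world in it, that is, over the nonempty substates, so the induction must vary the
state. -/
theorem PL.stateForm_decides_Kh (α : PL P) (hα : α.Over {p | p ∈ A}) (s : Finset W)
    (hs : s.Nonempty) :
    (α.Supp V s → Provable ((stateForm V A s).imp (Kh α))) ∧
      (¬ α.Supp V s → Provable ((stateForm V A s).imp (neg (Kh α)))) := by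
  induction α generalizing s with
  | atom p =>
    refine ⟨fun h => ?_, fun h => ?_⟩
    · have : Provable ((stateForm V A s).imp (K (Formula.atom p))) := stateForm_imp_K fun w hw =>
        .TAUT _ fun v hv => ((boolTrue_desc v w).1 hv.2 p hα).1 (h w hw)
      exact this.trans (.KKhp p)
    · simp only [PL.Supp, not_forall] at h
      obtain ⟨w, hw, hp⟩ := h
      have : Provable ((stateForm V A s).imp (neg (K (Formula.atom p)))) :=
        stateForm_imp_not_K hw <| .TAUT _ fun v hv hn => hp (((boolTrue_desc v w).1 hv.2 p hα).2 hn)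
      exact this.of_taut₂ (Provable.KhK (.atom p)) fun v h h₁ h₂ h₃ => h h₂ (h₁ h₃)
  | bot =>
    exact ⟨fun h => h.elim, fun _ => Provable.KhBot.of_taut₁ fun v h _ h₁ => h.1 h₁⟩
  | and α β ha hb =>
    have ha := ha hα.1 s hs
    have hb := hb hα.2 s hs
    refine ⟨fun h => ?_, fun h => ?_⟩
    · exact .of_taut₃ (ha.1 h.1) (hb.1 h.2) (.KhAnd α β) fun v h₁ h₂ h₃ h => h₃.2 ⟨h₁ h, h₂ h⟩
    · rcases not_and_or.1 h with h | h
      · exact .of_taut₂ (ha.2 h) (.KhAnd α β) fun v h₁ h₂ h h' => h₁ h (h₂.1 h').1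
      · exact .of_taut₂ (hb.2 h) (.KhAnd α β) fun v h₁ h₂ h h' => h₁ h (h₂.1 h').2
  | or α β ha hb =>
    have ha := ha hα.1 s hs
    have hb := hb hα.2 s hs
    refine ⟨fun h => ?_, fun h => ?_⟩
    · rcases h with h | h
      · exact .of_taut₂ (ha.1 h) (.KhOr α β) fun v h₁ h₂ h => h₂.2 (.inl (h₁ h))
      · exact .of_taut₂ (hb.1 h) (.KhOr α β) fun v h₁ h₂ h => h₂.2 (.inr (h₁ h))
    · obtain ⟨h₁, h₂⟩ := not_or.1 h
      exact .of_taut₃ (ha.2 h₁) (hb.2 h₂) (.KhOr α β) fun v h₁ h₂ h₃ h h' =>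
        (h₃.1 h').elim (h₁ h) (h₂ h)
  | imp α β ha hb =>
    refine ⟨fun h => ?_, fun h => ?_⟩
    · have : Provable ((stateForm V A s).imp (K (box ((Kh α).imp (Kh β))))) := by
        refine stateForm_imp_K fun w hw => pointed_imp_box hw fun t hts hwt => ?_
        have ht : t.Nonempty := ⟨w, hwt⟩
        by_cases hsupp : α.Supp V t
        · have := (hb hα.2 t ht).1 (h t (Finset.coe_subset.2 hts) (by simpa using ht) hsupp)
          exact this.of_taut₁ fun v h h₁ _ => h h₁.1
        · exact ((ha hα.1 t ht).2 hsupp).of_taut₁ fun v h h₁ h₂ => (h h₁.1 h₂).elim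
      exact .of_taut₂ this (.KhImp α β) fun v h₁ h₂ h => h₂.2 (h₁ h)
    · simp only [PL.Supp, not_forall] at h
      obtain ⟨t, hts, ht, h₁, h₂⟩ := h
      obtain ⟨t, hts, rfl⟩ := exists_finset_subset hts
      obtain ⟨w, hw⟩ := ht
      have : Provable ((stateForm V A s).imp (neg (K (box ((Kh α).imp (Kh β)))))) := by
        refine stateForm_imp_not_K (hts hw) (pointed_imp_not_box hts hw ?_)
        exact .of_taut₂ ((ha hα.1 t ⟨w, hw⟩).1 h₁) ((hb hα.2 t ⟨w, hw⟩).2 h₂)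
          fun v h₁ h₂ h h' => h₂ h.1 (h' (h₁ h.1))
      exact .of_taut₂ this (.KhImp α β) fun v h₁ h₂ h h' => h₁ h (h₂.1 h')

/-- The truth lemma. Both answers are carried through the induction, since implications and negated
modalities need refutations as well as proofs. -/
theorem Formula.pointed_decides (φ : Formula P) (hφ : φ.Over {p | p ∈ A}) (s : Finset W) (w : W)
    (hw : w ∈ s) :
    (φ.Sat V s w → Provable ((pointed V A s w).imp φ)) ∧
      (¬ φ.Sat V s w → Provable ((pointed V A s w).imp (neg φ))) := by
  induction φ generalizing s w with
  | atom p =>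
    exact ⟨fun h => .TAUT _ fun v hv => ((boolTrue_desc v w).1 hv.2 p hφ).1 h,
      fun h => .TAUT _ fun v hv hn => h (((boolTrue_desc v w).1 hv.2 p hφ).2 hn)⟩
  | bot => exact ⟨fun h => h.elim, fun _ => .TAUT _ fun v _ h => h⟩
  | and φ ψ h₁ h₂ =>
    have h₁ := h₁ hφ.1 s w hw
    have h₂ := h₂ hφ.2 s w hw
    refine ⟨fun h => .of_taut₂ (h₁.1 h.1) (h₂.1 h.2) fun v h₁ h₂ h => ⟨h₁ h, h₂ h⟩, fun h => ?_⟩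
    rcases not_and_or.1 h with h | h
    · exact (h₁.2 h).of_taut₁ fun v h h₁ h₂ => h h₁ h₂.1
    · exact (h₂.2 h).of_taut₁ fun v h h₁ h₂ => h h₁ h₂.2
  | or φ ψ h₁ h₂ =>
    have h₁ := h₁ hφ.1 s w hw
    have h₂ := h₂ hφ.2 s w hw
    refine ⟨fun h => ?_, fun h => ?_⟩
    · rcases h with h | h
      · exact (h₁.1 h).of_taut₁ fun v h h₁ => .inl (h h₁)
      · exact (h₂.1 h).of_taut₁ fun v h h₁ => .inr (h h₁)
    · obtain ⟨ha, hb⟩ := not_or.1 h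
      exact .of_taut₂ (h₁.2 ha) (h₂.2 hb) fun v h₁ h₂ h h' => h'.elim (h₁ h) (h₂ h)
  | imp φ ψ h₁ h₂ =>
    have h₁ := h₁ hφ.1 s w hw
    have h₂ := h₂ hφ.2 s w hw
    refine ⟨fun h => ?_, fun h => ?_⟩
    · by_cases ha : φ.Sat V s w
      · exact (h₂.1 (h ha)).of_taut₁ fun v h h₁ _ => h h₁
      · exact (h₁.2 ha).of_taut₁ fun v h h₁ h₂ => (h h₁ h₂).elim
    · obtain ⟨ha, hb⟩ := Classical.not_imp.1 h
      exact .of_taut₂ (h₁.1 ha) (h₂.2 hb) fun v h₁ h₂ h h' => h₂ h (h' (h₁ h))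
  | K φ ih =>
    refine ⟨fun h => ?_, fun h => ?_⟩
    · exact (stateForm_imp_K fun u hu => (ih hφ s u hu).1 (h u hu)).of_taut₁
        fun v h h' => h h'.1
    · simp only [Formula.Sat, not_forall] at h
      obtain ⟨u, hu, h⟩ := h
      exact (stateForm_imp_not_K hu ((ih hφ s u hu).2 h)).of_taut₁ fun v h h' => h h'.1
  | Kh α =>
    have := α.stateForm_decides_Kh (V := V) hφ s ⟨w, hw⟩
    exact ⟨fun h => (this.1 h).of_taut₁ fun v h h' => h h'.1,
      fun h => (this.2 h).of_taut₁ fun v h h' => h h'.1⟩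
  | box φ ih =>
    refine ⟨fun h => ?_, fun h => ?_⟩
    · exact pointed_imp_box hw fun t hts hwt =>
        (ih hφ t w hwt).1 (h t (Finset.coe_subset.2 hts) hwt)
    · simp only [Formula.Sat, not_forall] at h
      obtain ⟨t, hts, hwt, h⟩ := h
      obtain ⟨t, hts, rfl⟩ := exists_finset_subset hts
      exact pointed_imp_not_box hts hwt ((ih hφ t w hwt).2 h)

/-- Completeness of `SDELKh` for the substates of a finite set of worlds that realizes all
valuations of the letters in question. -/
theorem Provable.of_sat {U : Finset W} (hU : ∀ v : P → Prop, ∃ w ∈ U, ∀ p ∈ A, (V w p ↔ v p))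
    {φ : Formula P} (hφ : φ.Over {p | p ∈ A})
    (h : ∀ s ⊆ U, ∀ w ∈ s, φ.Sat V s w) : Provable φ := by
  -- Since `U` realizes every valuation of `A`, its cover is a tautology, and necessitation makes it
  -- known.
  have hcov : Provable (cover V A U).toFormula := .TAUT _ fun v => by
    obtain ⟨w, hw, hv⟩ := hU fun p => v (.atom p)
    exact (boolTrue_cover v U).2 ⟨w, hw, (boolTrue_desc v w).2 hv⟩
  have hw (w : W) (hw : w ∈ U) :
      Provable (((K (cover V A U).toFormula).and (desc V A w).toFormula).imp φ) :=
    K_cover_imp hw fun t hts hwt => (φ.pointed_decides hφ t w hwt).1 (h t hts w hwt)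
  refine .of_taut ((cover V A U).toFormula :: K (cover V A U).toFormula :: U.toList.map fun w =>
    ((K (cover V A U).toFormula).and (desc V A w).toFormula).imp φ) ?_ ?_
  · simp only [List.mem_cons, List.mem_map, Finset.mem_toList]
    rintro γ (rfl | rfl | ⟨w, hwU, rfl⟩)
    exacts [hcov, .necK _ hcov, hw w hwU]
  · intro v hv
    simp only [List.mem_cons, List.mem_map, Finset.mem_toList] at hv
    obtain ⟨w, hwU, hd⟩ := (boolTrue_cover v U).1 (hv _ (.inl rfl))
    exact hv _ (.inr (.inr ⟨w, hwU, rfl⟩)) ⟨hv _ (.inr (.inl rfl)), hd⟩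

end Descriptions

/-! ### Worlds and states as numbers; course-of-values evaluation. -/

section Coded

/-- The set of natural numbers with characteristic bits `n`. -/
def bitSet (n : ℕ) : Set ℕ := {v | n.testBit v}

theorem mem_bitSet {n v : ℕ} : v ∈ bitSet n ↔ n.testBit v = true := Iff.rfl

theorem lt_of_mem_bitSet {M n v : ℕ} (hn : n < 2 ^ M) (hv : v ∈ bitSet n) : v < M := by
  by_contra h
  rw [mem_bitSet, Nat.testBit_lt_two_pow (hn.trans_le (Nat.pow_le_pow_right two_pos
    (not_lt.1 h)))] at hv
  exact Bool.false_ne_true hv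

theorem exists_bitSet_eq {M : ℕ} {t : Set ℕ} (ht : ∀ v ∈ t, v < M) :
    ∃ n < 2 ^ M, bitSet n = t := by
  classical
  refine ⟨Nat.ofBits fun i : Fin M => decide ((i : ℕ) ∈ t), Nat.ofBits_lt_two_pow _, ?_⟩
  ext v
  rw [mem_bitSet]
  rcases lt_or_ge v M with h | h
  · rw [Nat.testBit_ofBits_lt _ _ h]
    simp
  · rw [Nat.testBit_ofBits_ge _ _ h]
    simpa using fun hv => (ht v hv).not_ge h

theorem bitSet_nonempty {n : ℕ} : (bitSet n).Nonempty ↔ n ≠ 0 := by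
  refine ⟨?_, fun h => Nat.exists_testBit_of_ne_zero h⟩
  rintro ⟨v, hv⟩ rfl
  simp [bitSet] at hv

theorem bitSet_subset_iff {M m n : ℕ} (hm : m < 2 ^ M) :
    bitSet m ⊆ bitSet n ↔ ∀ v < M, m.testBit v = true → n.testBit v = true :=
  ⟨fun h _ _ hv => h hv, fun h v hv => h v (lt_of_mem_bitSet hm hv) hv⟩

/-- Turns quantification over substates into bounded quantification over numbers, which preserves
primitive recursiveness. -/
theorem forall_subset_bitSet {M s : ℕ} (hs : s < 2 ^ M) {p : Set ℕ → Prop} :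
    (∀ t ⊆ bitSet s, p t) ↔
      ∀ u < 2 ^ M, (∀ v < M, u.testBit v = true → s.testBit v = true) → p (bitSet u) := by
  refine ⟨fun h u hu hus => h _ ((bitSet_subset_iff hu).2 hus), fun h t ht => ?_⟩
  obtain ⟨u, hu, rfl⟩ := exists_bitSet_eq (M := M) fun v hv => lt_of_mem_bitSet hs (ht hv)
  exact h u hu ((bitSet_subset_iff hu).1 ht)

/-- The table of the values below `n` of a function defined by course-of-values recursion. -/
def courseTable {σ : Type*} (g : ℕ → List σ → σ) (N : ℕ) : ℕ → List σ
  | 0 => []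
  | n + 1 => courseTable g N n ++ [g N (courseTable g N n)]

variable {σ : Type*} {g : ℕ → List σ → σ}

@[simp] theorem length_courseTable (N n : ℕ) : (courseTable g N n).length = n := by
  induction n <;> simp_all [courseTable]

theorem courseTable_getD (N : ℕ) {n k : ℕ} (hk : k < n) (d : σ) :
    (courseTable g N n).getD k d = g N (courseTable g N k) := by
  induction n with
  | zero => omega
  | succ n ih =>
    rw [courseTable]
    rcases (Nat.lt_succ_iff_lt_or_eq.1 hk) with h | rfl
    · rw [List.getD_append _ _ _ _ (by simpa using h), ih h]
    · rw [List.getD_append_right _ _ _ _ (by simp)]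
      simp

theorem primrec_courseTable [Primcodable σ] (hg : Primrec₂ g) : Primrec₂ (courseTable g) := by
  have h : Primrec₂ fun (N : ℕ) (q : ℕ × List σ) => q.2 ++ [g N q.2] :=
    Primrec.list_concat.comp (Primrec.snd.comp Primrec.snd)
      (hg.comp Primrec.fst (Primrec.snd.comp Primrec.snd))
  refine (Primrec.nat_rec (Primrec.const []) h).of_eq fun N n => ?_
  induction n <;> simp_all [courseTable]

open Classical in
/-- The list of the numbers below `B N` that satisfy `R N l`. -/
noncomputable def filterBelow (B : ℕ → ℕ) (R : ℕ → List (List ℕ) → ℕ → Prop) (N : ℕ)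
    (l : List (List ℕ)) : List ℕ :=
  (List.range (B N)).filter (R N l)

theorem mem_filterBelow {B : ℕ → ℕ} {R : ℕ → List (List ℕ) → ℕ → Prop} {N : ℕ}
    {l : List (List ℕ)} {x : ℕ} : x ∈ filterBelow B R N l ↔ x < B N ∧ R N l x := by
  simp [filterBelow]

/-- Support at the state `s` of the propositional formula with code `Nat.pair t m`, where `X` and
`Y` list the states that support its components. -/
def SuppClause (N t m : ℕ) (X Y : List ℕ) (s : ℕ) : Prop :=
  (t = 0 ∧ ∀ w < 2 ^ N, ¬ s.testBit w = true ∨ w.testBit m = true) ∨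
  (t = 2 ∧ s ∈ X ∧ s ∈ Y) ∨
  (t = 3 ∧ (s ∈ X ∨ s ∈ Y)) ∨
  (t = 4 ∧ ∀ u < 2 ^ 2 ^ N,
    (¬ ∀ v < 2 ^ N, ¬ u.testBit v = true ∨ s.testBit v = true) ∨ u = 0 ∨ ¬ u ∈ X ∨ u ∈ Y)

/-- The recursion step for `suppList`. -/
noncomputable def suppStep : ℕ → List (List ℕ) → List ℕ :=
  filterBelow (fun N => 2 ^ 2 ^ N) fun N l s =>
    SuppClause N l.length.unpair.1 l.length.unpair.2 (l.getD l.length.unpair.2.unpair.1 [])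
      (l.getD l.length.unpair.2.unpair.2 []) s

/-- The states below `2 ^ 2 ^ N` that support the propositional formula with code `n`. -/
noncomputable def suppList (N n : ℕ) : List ℕ := suppStep N (courseTable suppStep N n)

/-- Truth at the pair `x` of a state and a world of the formula with code `Nat.pair t m`, where
`X`, `Y`, `Z` list the pairs that satisfy its components, and `Q` lists the states that support the
propositional formula with code `m`. -/
def SatClause (N t m : ℕ) (X Y Z Q : List ℕ) (x : ℕ) : Prop :=
  (t = 0 ∧ x.unpair.2.testBit m = true) ∨
  (t = 2 ∧ x ∈ X ∧ x ∈ Y) ∨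
  (t = 3 ∧ (x ∈ X ∨ x ∈ Y)) ∨
  (t = 4 ∧ (¬ x ∈ X ∨ x ∈ Y)) ∨
  (t = 5 ∧ ∀ v < 2 ^ N, ¬ x.unpair.1.testBit v = true ∨ Nat.pair x.unpair.1 v ∈ Z) ∨
  (t = 6 ∧ x.unpair.1 ∈ Q) ∨
  (t = 7 ∧ ∀ u < 2 ^ 2 ^ N,
    (¬ ∀ v < 2 ^ N, ¬ u.testBit v = true ∨ x.unpair.1.testBit v = true) ∨
    ¬ u.testBit x.unpair.2 = true ∨ Nat.pair u x.unpair.2 ∈ Z)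

/-- The recursion step for `satList`. -/
noncomputable def satStep : ℕ → List (List ℕ) → List ℕ :=
  filterBelow (fun N => Nat.pair (2 ^ 2 ^ N) (2 ^ N)) fun N l x =>
    SatClause N l.length.unpair.1 l.length.unpair.2 (l.getD l.length.unpair.2.unpair.1 [])
      (l.getD l.length.unpair.2.unpair.2 []) (l.getD l.length.unpair.2 [])
      (suppList N l.length.unpair.2) x

/-- The pairs of a state and a world that satisfy the formula with code `n`. -/
noncomputable def satList (N n : ℕ) : List ℕ := satStep N (courseTable satStep N n)

/-- Guarantees that the table already contains the entries of components. It needs a positive tag: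
`Nat.pair 0 m` can equal `m`, so atoms are treated separately, their clause consulting no table
entry. -/
theorem lt_pair {t x m : ℕ} (h : 0 < t) (hx : x ≤ m) : x < Nat.pair t m := by
  have := Nat.add_le_pair t m
  omega

theorem mem_suppList_pair_zero {N m s : ℕ} (hs : s < 2 ^ 2 ^ N) :
    s ∈ suppList N (Nat.pair 0 m) ↔ SuppClause N 0 m [] [] s := by
  simp only [suppList, suppStep, mem_filterBelow, hs, true_and, length_courseTable,
    Nat.unpair_pair]
  simp [SuppClause]

theorem mem_suppList_pair {N t m s : ℕ} (ht : 0 < t) (hs : s < 2 ^ 2 ^ N) :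
    s ∈ suppList N (Nat.pair t m) ↔
      SuppClause N t m (suppList N m.unpair.1) (suppList N m.unpair.2) s := by
  conv_lhs => rw [suppList, suppStep, mem_filterBelow]
  simp only [hs, true_and, length_courseTable, Nat.unpair_pair]
  rw [← suppStep, courseTable_getD N (lt_pair ht (Nat.unpair_left_le m)),
    courseTable_getD N (lt_pair ht (Nat.unpair_right_le m))]
  rfl

theorem mem_satList_pair_zero {N m x : ℕ} (hx : x < Nat.pair (2 ^ 2 ^ N) (2 ^ N)) :
    x ∈ satList N (Nat.pair 0 m) ↔ SatClause N 0 m [] [] [] [] x := by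
  simp only [satList, satStep, mem_filterBelow, hx, true_and, length_courseTable,
    Nat.unpair_pair]
  simp [SatClause]

theorem mem_satList_pair {N t m x : ℕ} (ht : 0 < t) (hx : x < Nat.pair (2 ^ 2 ^ N) (2 ^ N)) :
    x ∈ satList N (Nat.pair t m) ↔ SatClause N t m (satList N m.unpair.1)
      (satList N m.unpair.2) (satList N m) (suppList N m) x := by
  conv_lhs => rw [satList, satStep, mem_filterBelow]
  simp only [hx, true_and, length_courseTable, Nat.unpair_pair]
  rw [← satStep, courseTable_getD N (lt_pair ht (Nat.unpair_left_le m)),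
    courseTable_getD N (lt_pair ht (Nat.unpair_right_le m)), courseTable_getD N (lt_pair ht le_rfl)]
  rfl

/-! ### The lists compute support and truth; provability as a bounded check. -/

section Correctness

variable {P : Type*} [Encodable P]

/-- The valuation coded by the bits of a natural number. -/
def bitVal (P : Type*) [Encodable P] (w : ℕ) (p : P) : Prop :=
  w.testBit (Encodable.encode p) = true

theorem mem_suppList (N : ℕ) (α : PL P) {s : ℕ} (hs : s < 2 ^ 2 ^ N) :
    s ∈ suppList N α.code ↔ α.Supp (bitVal P) (bitSet s) := by
  induction α generalizing s with
  | atom p =>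
    rw [PL.code, mem_suppList_pair_zero hs]
    simp only [SuppClause, PL.Supp, bitVal, mem_bitSet, ← imp_iff_not_or]
    simpa using ⟨fun h w hw => h w (lt_of_mem_bitSet hs hw) hw, fun h w _ => h w⟩
  | bot =>
    rw [PL.code, mem_suppList_pair one_pos hs]
    simp [SuppClause, PL.Supp]
  | and α β ha hb =>
    rw [PL.code, mem_suppList_pair two_pos hs]
    simp [SuppClause, PL.Supp, ha hs, hb hs]
  | or α β ha hb =>
    rw [PL.code, mem_suppList_pair three_pos hs]
    simp [SuppClause, PL.Supp, ha hs, hb hs]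
  | imp α β ha hb =>
    rw [PL.code, mem_suppList_pair four_pos hs]
    simp only [PL.Supp, forall_subset_bitSet hs, bitSet_nonempty]
    simp only [SuppClause, ← imp_iff_not_or, Nat.unpair_pair]
    simp only [OfNat.ofNat_ne_zero, false_and, Nat.reduceEqDiff, true_and, false_or]
    refine forall₂_congr fun u hu => imp_congr_right fun _ => ?_
    rw [ha hu, hb hu, ← or_iff_not_imp_left]

theorem mem_satList (N : ℕ) (φ : Formula P) {s w : ℕ} (hs : s < 2 ^ 2 ^ N) (hw : w < 2 ^ N) :
    Nat.pair s w ∈ satList N φ.code ↔ φ.Sat (bitVal P) (bitSet s) w := by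
  -- Monotonicity of pairing puts every relevant pair below the bound. The range may also contain
  -- pairs with a component out of bounds, which are never consulted.
  have hx {s w : ℕ} (hs : s < 2 ^ 2 ^ N) (hw : w < 2 ^ N) :
      Nat.pair s w < Nat.pair (2 ^ 2 ^ N) (2 ^ N) :=
    (Nat.pair_lt_pair_left _ hs).trans (Nat.pair_lt_pair_right _ hw)
  induction φ generalizing s w with
  | atom p =>
    rw [Formula.code, mem_satList_pair_zero (hx hs hw)]
    simp [SatClause, Formula.Sat, bitVal]
  | bot =>
    rw [Formula.code, mem_satList_pair one_pos (hx hs hw)]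
    simp [SatClause, Formula.Sat]
  | and φ ψ h₁ h₂ =>
    rw [Formula.code, mem_satList_pair two_pos (hx hs hw)]
    simp [SatClause, Formula.Sat, h₁ hs hw, h₂ hs hw]
  | or φ ψ h₁ h₂ =>
    rw [Formula.code, mem_satList_pair three_pos (hx hs hw)]
    simp [SatClause, Formula.Sat, h₁ hs hw, h₂ hs hw]
  | imp φ ψ h₁ h₂ =>
    rw [Formula.code, mem_satList_pair four_pos (hx hs hw)]
    simp [SatClause, Formula.Sat, h₁ hs hw, h₂ hs hw, imp_iff_not_or]
  | K φ ih =>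
    rw [Formula.code, mem_satList_pair (by simp) (hx hs hw)]
    simp only [SatClause, Formula.Sat, Nat.unpair_pair, ← imp_iff_not_or, mem_bitSet]
    simp only [OfNat.ofNat_ne_zero, false_and, Nat.reduceEqDiff, true_and, false_or, or_false]
    exact ⟨fun h v hv => (ih hs (lt_of_mem_bitSet hs hv)).1 (h v (lt_of_mem_bitSet hs hv) hv),
      fun h v hv hvs => (ih hs hv).2 (h v hvs)⟩
  | Kh α =>
    rw [Formula.code, mem_satList_pair (by simp) (hx hs hw)]
    simp [SatClause, Formula.Sat, mem_suppList N α hs]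
  | box φ ih =>
    rw [Formula.code, mem_satList_pair (by simp) (hx hs hw)]
    simp only [Formula.Sat, forall_subset_bitSet hs]
    simp only [SatClause, Nat.unpair_pair, ← imp_iff_not_or, mem_bitSet]
    simp only [OfNat.ofNat_ne_zero, false_and, Nat.reduceEqDiff, true_and, false_or]
    refine forall₂_congr fun u hu => imp_congr_right fun _ =>
      imp_congr_right fun _ => ?_
    exact ih hu hw

/-- Pairing dominates its components, so the code of a formula bounds the codes of its letters and
tells how many bits a world needs. -/
theorem PL.over_of_code_lt {N : ℕ} (α : PL P) (h : α.code < N) :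
    α.Over {p | Encodable.encode p < N} := by
  have l (t a b : ℕ) : a ≤ Nat.pair t (Nat.pair a b) :=
    (Nat.left_le_pair a b).trans (Nat.right_le_pair t _)
  have r (t a b : ℕ) : b ≤ Nat.pair t (Nat.pair a b) :=
    (Nat.right_le_pair a b).trans (Nat.right_le_pair t _)
  induction α with
  | atom p => exact (Nat.right_le_pair _ _).trans_lt h
  | bot => trivial
  | and α β ha hb => exact ⟨ha ((l _ _ _).trans_lt h), hb ((r _ _ _).trans_lt h)⟩
  | or α β ha hb => exact ⟨ha ((l _ _ _).trans_lt h), hb ((r _ _ _).trans_lt h)⟩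
  | imp α β ha hb => exact ⟨ha ((l _ _ _).trans_lt h), hb ((r _ _ _).trans_lt h)⟩

theorem Formula.over_of_code_lt {N : ℕ} (φ : Formula P) (h : φ.code < N) :
    φ.Over {p | Encodable.encode p < N} := by
  have l (t a b : ℕ) : a ≤ Nat.pair t (Nat.pair a b) :=
    (Nat.left_le_pair a b).trans (Nat.right_le_pair t _)
  have r (t a b : ℕ) : b ≤ Nat.pair t (Nat.pair a b) :=
    (Nat.right_le_pair a b).trans (Nat.right_le_pair t _)
  induction φ with
  | atom p => exact (Nat.right_le_pair _ _).trans_lt h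
  | bot => trivial
  | and φ ψ ha hb => exact ⟨ha ((l _ _ _).trans_lt h), hb ((r _ _ _).trans_lt h)⟩
  | or φ ψ ha hb => exact ⟨ha ((l _ _ _).trans_lt h), hb ((r _ _ _).trans_lt h)⟩
  | imp φ ψ ha hb => exact ⟨ha ((l _ _ _).trans_lt h), hb ((r _ _ _).trans_lt h)⟩
  | K φ ih => exact ih ((Nat.right_le_pair _ _).trans_lt h)
  | Kh α => exact α.over_of_code_lt ((Nat.right_le_pair _ _).trans_lt h)
  | box φ ih => exact ih ((Nat.right_le_pair _ _).trans_lt h)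

/-- Provability amounts to truth at all worlds of all states over the letters of the formula. -/
theorem provable_iff (φ : Formula P) : Provable φ ↔
    ∀ s < 2 ^ 2 ^ (φ.code + 1), ∀ w < 2 ^ (φ.code + 1),
      ¬ s.testBit w = true ∨ Nat.pair s w ∈ satList (φ.code + 1) φ.code := by
  set N := φ.code + 1 with hN
  simp only [← imp_iff_not_or]
  refine ⟨fun h s hs w hw hsw => (mem_satList N φ hs hw).2 (h.sat _ w hsw), fun h => ?_⟩
  -- `decode₂` inverts `encode` exactly, so `A` consists of precisely the letters with code below
  -- `N`.
  let A : List P := (List.range N).filterMap (Encodable.decode₂ P)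
  have hA : {p | p ∈ A} = {p : P | Encodable.encode p < N} := by
    ext p
    simp only [A, Set.mem_ofPred_eq, List.mem_filterMap, List.mem_range,
      Encodable.decode₂_eq_some]
    simp
  refine Provable.of_sat (V := bitVal P) (A := A) (U := Finset.range (2 ^ N)) ?_
    (hA ▸ φ.over_of_code_lt (by omega)) ?_
  · intro v
    -- The world realizing `v` has a bit set for each letter of code below `N` that `v` makes true.
    obtain ⟨w, hw, h⟩ := exists_bitSet_eq (M := N)
      (t := {n | n < N ∧ ∃ p : P, Encodable.encode p = n ∧ v p}) fun n hn => hn.1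
    refine ⟨w, by simpa using hw, fun p hp => ?_⟩
    have hp : Encodable.encode p < N := hA.le hp
    rw [bitVal, ← mem_bitSet, h]
    simp [hp]
  · intro t ht w hw
    obtain ⟨s, hs, h'⟩ := exists_bitSet_eq (M := 2 ^ N) (t := (t : Set ℕ)) fun v hv => by
      simpa using ht hv
    have hw' : w < 2 ^ N := by simpa using ht hw
    rw [← h']
    refine (mem_satList N φ hs hw').1 (h s hs w hw' ?_)
    rw [← mem_bitSet, h']
    exact hw

end Correctness

/-! ### Primitive recursiveness of the check. -/

section Recursive

theorem primrec_two_pow {α : Type*} [Primcodable α] {f : α → ℕ} (hf : Primrec f) :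
    Primrec fun a => 2 ^ f a :=
  (Primrec₂.unpaired'.1 Nat.Primrec.pow).comp (Primrec.const 2) hf

variable {α : Type*} [Primcodable α]

theorem primrecPred_testBit {f h : α → ℕ} (hf : Primrec f) (hh : Primrec h) :
    PrimrecPred fun a => (f a).testBit (h a) = true := by
  refine (Primrec.eq.comp (Primrec.nat_mod.comp
    (Primrec.nat_div.comp hf (primrec_two_pow hh)) (Primrec.const 2)) (Primrec.const 1)).of_eq ?_
  simp [Nat.testBit_eq_decide_div_mod_eq]

theorem primrecPred_forall_lt {f : α → ℕ} {p : α → ℕ → Prop} (hf : Primrec f)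
    (hp : PrimrecPred fun q : α × ℕ => p q.1 q.2) : PrimrecPred fun a => ∀ n < f a, p a n :=
  ((PrimrecRel.forall_mem_list (R := fun n a => p a n)
    (hp.comp (Primrec.pair Primrec.snd Primrec.fst))).comp
      (Primrec.list_range.comp hf) Primrec.id).of_eq (by simp)

theorem primrecPred_mem {f : α → ℕ} {L : α → List ℕ} (hf : Primrec f) (hL : Primrec L) :
    PrimrecPred fun a => f a ∈ L a :=
  ((PrimrecRel.exists_mem_list Primrec.eq).comp hL hf).of_eq (by simp)

theorem primrecPred_bits_subset {f h b : α → ℕ} (hf : Primrec f) (hh : Primrec h)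
    (hb : Primrec b) :
    PrimrecPred fun a => ∀ v < b a, ¬ (f a).testBit v = true ∨ (h a).testBit v = true :=
  primrecPred_forall_lt hb ((primrecPred_testBit (hf.comp .fst) .snd).not.or
    (primrecPred_testBit (hh.comp .fst) .snd))

theorem primrec_filterBelow {B : ℕ → ℕ} {R : ℕ → List (List ℕ) → ℕ → Prop} (hB : Primrec B)
    (hR : PrimrecPred fun q : ℕ × ℕ × List (List ℕ) => R q.2.1 q.2.2 q.1) :
    Primrec₂ (filterBelow B R) := by
  classical
  have h := (PrimrecRel.listFilter
    (R := fun (x : ℕ) (q : ℕ × List (List ℕ)) => R q.1 q.2 x) hR).comp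
    (Primrec.list_range.comp (hB.comp .fst)) (Primrec.id (α := ℕ × List (List ℕ)))
  refine h.of_eq fun q => ?_
  rw [filterBelow]
  -- The two filters differ only in their decidability instances.
  congr

/-- The clause is built from bit tests, list membership, equality, Boolean connectives and bounded
quantifiers; its implications are written as disjunctions so that these closure properties apply
directly. -/
theorem PrimrecPred.suppClause {N t m s : α → ℕ} {X Y : α → List ℕ} (hN : Primrec N)
    (ht : Primrec t) (hm : Primrec m) (hX : Primrec X) (hY : Primrec Y) (hs : Primrec s) :
    PrimrecPred fun a => SuppClause (N a) (t a) (m a) (X a) (Y a) (s a) := by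
  have he (k : ℕ) : PrimrecPred fun a => t a = k := Primrec.eq.comp ht (.const k)
  have hN' := primrec_two_pow hN
  refine ((he 0).and (primrecPred_forall_lt hN' ?_)).or
    (((he 2).and ((primrecPred_mem hs hX).and (primrecPred_mem hs hY))).or
    (((he 3).and ((primrecPred_mem hs hX).or (primrecPred_mem hs hY))).or
    ((he 4).and (primrecPred_forall_lt (primrec_two_pow hN') ?_))))
  · exact (primrecPred_testBit (hs.comp .fst) .snd).not.or
      (primrecPred_testBit .snd (hm.comp .fst))
  · exact (primrecPred_bits_subset .snd (hs.comp .fst) (hN'.comp .fst)).not.or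
      ((Primrec.eq.comp .snd (.const 0)).or ((primrecPred_mem .snd (hX.comp .fst)).not.or
        (primrecPred_mem .snd (hY.comp .fst))))

theorem PrimrecPred.satClause {N t m x : α → ℕ} {X Y Z Q : α → List ℕ} (hN : Primrec N)
    (ht : Primrec t) (hm : Primrec m) (hX : Primrec X) (hY : Primrec Y) (hZ : Primrec Z)
    (hQ : Primrec Q) (hx : Primrec x) :
    PrimrecPred fun a => SatClause (N a) (t a) (m a) (X a) (Y a) (Z a) (Q a) (x a) := by
  have he (k : ℕ) : PrimrecPred fun a => t a = k := Primrec.eq.comp ht (.const k)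
  have hN' := primrec_two_pow hN
  have hs : Primrec fun a => (x a).unpair.1 := Primrec.fst.comp (Primrec.unpair.comp hx)
  have hw : Primrec fun a => (x a).unpair.2 := Primrec.snd.comp (Primrec.unpair.comp hx)
  refine ((he 0).and (primrecPred_testBit hw hm)).or
    (((he 2).and ((primrecPred_mem hx hX).and (primrecPred_mem hx hY))).or
    (((he 3).and ((primrecPred_mem hx hX).or (primrecPred_mem hx hY))).or
    (((he 4).and ((primrecPred_mem hx hX).not.or (primrecPred_mem hx hY))).or
    (((he 5).and (primrecPred_forall_lt hN' ?_)).or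
    (((he 6).and (primrecPred_mem hs hQ)).or
    ((he 7).and (primrecPred_forall_lt (primrec_two_pow hN') ?_)))))))
  · exact (primrecPred_testBit (hs.comp .fst) .snd).not.or
      (primrecPred_mem (Primrec₂.natPair.comp (hs.comp .fst) .snd) (hZ.comp .fst))
  · exact (primrecPred_bits_subset .snd (hs.comp .fst) (hN'.comp .fst)).not.or
      ((primrecPred_testBit .snd (hw.comp .fst)).not.or
        (primrecPred_mem (Primrec₂.natPair.comp .snd (hw.comp .fst)) (hZ.comp .fst)))

theorem primrec_suppList : Primrec₂ suppList := by
  have hl : Primrec fun q : ℕ × ℕ × List (List ℕ) => q.2.2 := Primrec.snd.comp .snd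
  have hn : Primrec fun q : ℕ × ℕ × List (List ℕ) => q.2.2.length.unpair :=
    Primrec.unpair.comp (Primrec.list_length.comp hl)
  have hm := Primrec.snd.comp hn
  have hstep : Primrec₂ suppStep := by
    refine primrec_filterBelow (primrec_two_pow (primrec_two_pow .id)) ?_
    exact PrimrecPred.suppClause (Primrec.fst.comp .snd) (Primrec.fst.comp hn) hm
      ((Primrec.list_getD []).comp hl (Primrec.fst.comp (Primrec.unpair.comp hm)))
      ((Primrec.list_getD []).comp hl (Primrec.snd.comp (Primrec.unpair.comp hm))) .fst
  exact hstep.comp .fst (primrec_courseTable hstep)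

theorem primrec_satList : Primrec₂ satList := by
  have hl : Primrec fun q : ℕ × ℕ × List (List ℕ) => q.2.2 := Primrec.snd.comp .snd
  have hn : Primrec fun q : ℕ × ℕ × List (List ℕ) => q.2.2.length.unpair :=
    Primrec.unpair.comp (Primrec.list_length.comp hl)
  have hm := Primrec.snd.comp hn
  have hN : Primrec fun q : ℕ × ℕ × List (List ℕ) => q.2.1 := Primrec.fst.comp .snd
  have hstep : Primrec₂ satStep := by
    refine primrec_filterBelow (Primrec₂.natPair.comp
      (primrec_two_pow (primrec_two_pow .id)) (primrec_two_pow .id)) ?_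
    exact PrimrecPred.satClause hN (Primrec.fst.comp hn) hm
      ((Primrec.list_getD []).comp hl (Primrec.fst.comp (Primrec.unpair.comp hm)))
      ((Primrec.list_getD []).comp hl (Primrec.snd.comp (Primrec.unpair.comp hm)))
      ((Primrec.list_getD []).comp hl hm) (primrec_suppList.comp hN hm) .fst
  exact hstep.comp .fst (primrec_courseTable hstep)

theorem primrecPred_provable (P : Type*) [Primcodable P] :
    PrimrecPred fun φ : Formula P => Provable φ := by
  have hc : Primrec fun φ : Formula P => φ.code := Primrec.encode
  have hN : Primrec fun φ : Formula P => 2 ^ (φ.code + 1) :=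
    primrec_two_pow (Primrec.succ.comp hc)
  refine (primrecPred_forall_lt (primrec_two_pow hN) (primrecPred_forall_lt (hN.comp .fst)
    ((primrecPred_testBit (Primrec.snd.comp .fst) .snd).not.or (primrecPred_mem
      (Primrec₂.natPair.comp (Primrec.snd.comp .fst) .snd) (primrec_satList.comp
        (Primrec.succ.comp (hc.comp (Primrec.fst.comp .fst)))
          (hc.comp (Primrec.fst.comp .fst))))))).of_eq fun φ => (provable_iff φ).symm

end Recursive

end Coded

end SDELKh

theorem mainTheorem8 (P : Type*) [Primcodable P] :
    ComputablePred (fun φ : SDELKh.Formula P => SDELKh.Provable φ) := by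
  exact (SDELKh.primrecPred_provable P).computablePred
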